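/- **Conventions.** Let $X$ be a metric space. The length of a continuous path $\gamma:[a,b]\to X$ is $$\operatorname{length}(\gamma)=\sup\Big\{\sum_{i=1}^{m} d(\gamma(t_i),\gamma(t_{i+1})) : a=t_1<\dots<t_{m+1}=b\Big\}\in[0,\infty],$$ and $\gamma$ is a *shortest path* if $\operatorname{length}(\gamma)=d(\gamma(a),\gamma(b))$. $X$ is a *geodesic metric space* if any two of its points are joined by a shortest path. $X$ is *locally uniquely geodesic* if it is a geodesic metric space and there is $\varepsilon>0$ such that any two points at distance $\le\varepsilon$ are joined by a unique shortest path (unique once paths are parametrized on $[0,1]$ proportionally to arc length). A *periodic geodesic* in $X$ is a non-constant continuous map $\gamma:\mathbb R/\mathbb Z\to X$, parametrized proportionally to arc length, for which there is $\delta>0$ such that, for all real $s\le t$ with $t-s<\delta$, the arc $\gamma|_{[s,t]}$ is a shortest path, i.e. $d(\gamma(s),\gamma(t))=\operatorname{length}(\gamma|_{[s,t]})$. **Theorem.** Let $X$ be a compact locally uniquely geodesic metric space with $\pi_n(X,x)\neq 0$ for some $n\ge 1$ and some base point $x\in X$. Then $X$ contains a periodic geodesic. -/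

import Mathlib

open Set

open scoped unitInterval

namespace LocUniqGeod

/-- The length of a curve `γ` along a set `A` of parameters: the supremum of the sums
`∑ d(γ (t i), γ (t (i+1)))` over finite increasing sequences of points of `A`. -/
noncomputable def length {α X : Type*} [LinearOrder α] [MetricSpace X] (γ : α → X) (A : Set α) :
    ENNReal :=
  eVariationOn γ A

/-- A path is a shortest path if its length is the distance between its endpoints. -/
def IsShortestPath {X : Type*} [MetricSpace X] {x y : X} (γ : Path x y) : Prop :=
  length γ univ = edist x y

/-- A path on `[0,1]` is parametrized proportionally to arc length. -/
def IsProportional {X : Type*} [MetricSpace X] {x y : X} (γ : Path x y) : Prop :=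
  ∀ s t : I, s ≤ t → length γ (Icc s t) = ENNReal.ofReal ((t : ℝ) - s) * length γ univ

/-- Any two points can be joined by a shortest path. -/
def IsGeodesicSpace (X : Type*) [MetricSpace X] : Prop :=
  ∀ x y : X, ∃ γ : Path x y, IsShortestPath γ

/-- `X` is a geodesic space, and for some `ε > 0` any two points at distance at most `ε` are joined
by exactly one shortest path, up to parametrization (paths are normalized to be parametrized on
`[0,1]` proportionally to arc length). -/
def IsLocallyUniquelyGeodesic (X : Type*) [MetricSpace X] : Prop :=
  IsGeodesicSpace X ∧
    ∃ ε : ℝ, 0 < ε ∧ ∀ x y : X, dist x y ≤ ε →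
      ∃! γ : Path x y, IsShortestPath γ ∧ IsProportional γ

/-- A periodic geodesic: a non-constant closed curve `ℝ/ℤ → X`, parametrized proportionally to
arc length, all of whose sufficiently short arcs are shortest paths. Arcs of the circle are the
images of intervals `[s, t]` of the real line. -/
structure IsPeriodicGeodesic {X : Type*} [MetricSpace X] (γ : C(AddCircle (1 : ℝ), X)) : Prop where
  nonconstant : ∃ p q : AddCircle (1 : ℝ), γ p ≠ γ q
  locally_shortest : ∃ δ : ℝ, 0 < δ ∧ ∀ s t : ℝ, s ≤ t → t - s < δ →
    length (fun u : ℝ => γ (u : AddCircle (1 : ℝ))) (Icc s t) =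
      edist (γ (s : AddCircle (1 : ℝ))) (γ (t : AddCircle (1 : ℝ)))
  proportional : ∀ s t : ℝ, s ≤ t →
    length (fun u : ℝ => γ (u : AddCircle (1 : ℝ))) (Icc s t) =
      ENNReal.ofReal (t - s) * length (fun u : ℝ => γ (u : AddCircle (1 : ℝ))) (Icc 0 1)

end LocUniqGeod

/-! This is Birkhoff curve shortening on families of loops. View an element of the homotopy group as
a family of loops parametrized by a cube of one dimension less, and replace each loop by a closed
polygon with short edges. Passing to the polygon of edge midpoints moves the family by a homotopy
and does not raise the energy, the sum of squared edge lengths. If the energy stays the same and is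
positive, all edges are equally long and no corner can be cut, so the polygon is a periodic geodesic
(`SegmentMap.energy_eq_zero`).

Without periodic geodesics, compactness of the space of polygons makes the energy drop uniform, so
finitely many steps shrink the whole family (`SegmentMap.exists_iterate_midpoints_energy_le`) until
it contracts to constant loops (`SegmentMap.exists_homotopicWith_const`). Pulling in the tracks of
the base points turns this free homotopy into a based one (`homotopicWith_const_of_isLoopFamily`),
so every homotopy class is trivial. -/

namespace LocUniqGeod

/-- A family of constant speed segments joining the points of `X` at distance at most `ε`,
depending continuously on the endpoints. -/
structure SegmentMap (X : Type*) [MetricSpace X] (ε : ℝ) where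
  /-- The segment from `x` to `y`, parametrized on `[0,1]`. -/
  seg : X → X → ℝ → X
  seg_zero : ∀ {x y}, dist x y ≤ ε → seg x y 0 = x
  seg_one : ∀ {x y}, dist x y ≤ ε → seg x y 1 = y
  dist_seg : ∀ {x y}, dist x y ≤ ε → ∀ {s t}, s ∈ Icc (0 : ℝ) 1 → t ∈ Icc (0 : ℝ) 1 →
    dist (seg x y s) (seg x y t) = |s - t| * dist x y
  continuousOn_seg :
    ContinuousOn (fun p : (X × X) × ℝ => seg p.1.1 p.1.2 p.2) {p | dist p.1.1 p.1.2 ≤ ε}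

/-! ### Length and constant speed -/

section Length

variable {X : Type*} [MetricSpace X]

/-- The length of a curve whose distances are `c` times the distances of the parameters. -/
theorem length_Icc_of_dist_eq {α : Type*} [LinearOrder α] {f : α → X} {g : α → ℝ}
    (hg : Monotone g) {c : ℝ} (hc : 0 ≤ c) {s t : α} (hst : s ≤ t)
    (h : ∀ u ∈ Icc s t, ∀ w ∈ Icc s t, dist (f u) (f w) = |g u - g w| * c) :
    length f (Icc s t) = ENNReal.ofReal ((g t - g s) * c) := by
  have hm : MonotoneOn (fun u => g u * c) (Icc s t) :=
    fun u _ w _ huw => mul_le_mul_of_nonneg_right (hg huw) hc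
  have hs : s ∈ Icc s t := left_mem_Icc.2 hst
  have ht : t ∈ Icc s t := right_mem_Icc.2 hst
  have h1 : eVariationOn f (Icc s t) = eVariationOn (fun u => g u * c) (Icc s t) := by
    unfold eVariationOn
    congr 1
    ext p
    refine Finset.sum_congr rfl fun i _ => ?_
    rw [edist_dist, edist_dist, h _ (p.2.2.2 _) _ (p.2.2.2 _), Real.dist_eq, ← sub_mul, abs_mul,
      abs_of_nonneg hc]
  have h2 := hm.eVariationOn_eq hs ht
  rw [inter_self] at h2
  rw [length, h1, h2, sub_mul]

/-- Distance is at most length, so each of the three pieces cut off by `s` and `t` spans at most its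
share of `dist x y`. The shares add up to `dist x y`, and the triangle inequality forces equality.
-/
theorem dist_of_isShortestPath {x y : X} {γ : Path x y} (h1 : IsShortestPath γ)
    (h2 : IsProportional γ) (s t : I) : dist (γ s) (γ t) = |(s : ℝ) - t| * dist x y := by
  wlog hst : s ≤ t generalizing s t
  · rw [dist_comm, abs_sub_comm, this t s (le_of_not_ge hst)]
  have key : ∀ s t : I, s ≤ t → dist (γ s) (γ t) ≤ ((t : ℝ) - s) * dist x y := by
    intro s t hst
    have h := eVariationOn.edist_le γ (left_mem_Icc.2 hst) (right_mem_Icc.2 hst)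
    have h3 := h2 s t hst
    rw [h1] at h3
    rw [← length, h3, edist_dist, edist_dist, ← ENNReal.ofReal_mul (sub_nonneg.2 hst)] at h
    exact (ENNReal.ofReal_le_ofReal_iff (mul_nonneg (sub_nonneg.2 hst) dist_nonneg)).1 h
  have hs := key 0 s s.2.1
  have ht := key t 1 t.2.2
  have h := key s t hst
  have h3 := dist_triangle4 x (γ s) (γ t) y
  simp only [Path.source, Path.target, Icc.coe_zero, Icc.coe_one] at hs ht
  rw [abs_sub_comm, abs_of_nonneg (sub_nonneg.2 hst : (0 : ℝ) ≤ t - s)]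
  nlinarith

theorem isShortestPath_of_dist {x y : X} {γ : Path x y}
    (h : ∀ s t : I, dist (γ s) (γ t) = |(s : ℝ) - t| * dist x y) :
    IsShortestPath γ ∧ IsProportional γ := by
  have key : ∀ s t : I, s ≤ t →
      length γ (Icc s t) = ENNReal.ofReal (((t : ℝ) - s) * dist x y) := fun s t hst =>
    length_Icc_of_dist_eq (g := fun u : I => (u : ℝ)) (fun _ _ h => h) dist_nonneg hst
      fun u _ w _ => h u w
  have hu : length γ univ = edist x y := by
    have := key 0 1 zero_le_one
    rw [show Icc (0 : I) 1 = univ from Icc_bot_top] at this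
    simpa [edist_dist] using this
  refine ⟨hu, fun s t hst => ?_⟩
  rw [key s t hst, hu, edist_dist, ENNReal.ofReal_mul (sub_nonneg.2 hst)]

end Length

/-- A function with closed graph into a compact space is continuous. -/
theorem continuous_of_isClosed_graph {A B : Type*} [TopologicalSpace A] [TopologicalSpace B]
    [CompactSpace B] {f : A → B} (hf : IsClosed {p : A × B | f p.1 = p.2}) : Continuous f := by
  refine continuous_iff_isClosed.2 fun C hC => ?_
  have h := isClosedMap_fst_of_compactSpace (X := A) (Y := B) _
    (hf.inter (hC.preimage continuous_snd))
  convert h using 1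
  ext a
  simp

/-- Constant speed segments are cut out by closed conditions in the compact product `I → X`.
Uniqueness makes these conditions the graph of a function of the endpoints, which is therefore
continuous. -/
theorem exists_segmentMap {X : Type*} [MetricSpace X] [CompactSpace X]
    (hX : IsLocallyUniquelyGeodesic X) : ∃ ε : ℝ, 0 < ε ∧ Nonempty (SegmentMap X ε) := by
  obtain ⟨-, ε, hε, h⟩ := hX
  refine ⟨ε, hε, ?_⟩
  have h' : ∀ p : {p : X × X // dist p.1 p.2 ≤ ε}, ∃! g : I → X, g 0 = p.1.1 ∧ g 1 = p.1.2 ∧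
      ∀ s t : I, dist (g s) (g t) = |(s : ℝ) - t| * dist p.1.1 p.1.2 := by
    intro p
    obtain ⟨γ, ⟨h1, h2⟩, hu⟩ := h _ _ p.2
    refine ⟨γ, ⟨γ.source, γ.target, dist_of_isShortestPath h1 h2⟩, ?_⟩
    rintro g ⟨g0, g1, hg⟩
    have hgc : Continuous g := by
      refine (LipschitzWith.of_dist_le_mul (K := ⟨dist p.1.1 p.1.2, dist_nonneg⟩)
        fun s t => ?_).continuous
      rw [hg, Subtype.dist_eq, Real.dist_eq, mul_comm]
      rfl
    let γ' : Path p.1.1 p.1.2 := ⟨⟨g, hgc⟩, g0, g1⟩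
    have := hu γ' (isShortestPath_of_dist hg)
    exact congrArg (fun γ : Path p.1.1 p.1.2 => (γ : I → X)) this
  choose G hG hGu using h'
  have hGc : Continuous G := by
    refine continuous_of_isClosed_graph ?_
    have : {p : {p : X × X // dist p.1 p.2 ≤ ε} × (I → X) | G p.1 = p.2} = {p : {p : X × X // dist p.1 p.2 ≤ ε} × (I → X) | p.2 0 = p.1.1.1 ∧
        p.2 1 = p.1.1.2 ∧
        ∀ s t : I, dist (p.2 s) (p.2 t) = |(s : ℝ) - t| * dist p.1.1.1 p.1.1.2} := by
      ext ⟨p, g⟩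
      constructor
      · intro hg
        obtain rfl : G p = g := hg
        exact hG p
      · exact fun hg => (hGu p g hg).symm
    rw [this]
    simp only [ofPred_and, ofPred_forall]
    refine IsClosed.inter (isClosed_eq (by fun_prop) (by fun_prop))
      (IsClosed.inter (isClosed_eq (by fun_prop) (by fun_prop)) ?_)
    exact isClosed_iInter fun s => isClosed_iInter fun t =>
      isClosed_eq (by fun_prop) (by fun_prop)
  have hGj : Continuous fun q : {p : X × X // dist p.1 p.2 ≤ ε} × I => G q.1 q.2 := by
    -- Pointwise continuity upgrades to joint continuity because all segments share the Lipschitz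
    -- constant `diam X`.
    refine continuous_prod_of_continuous_lipschitzWith' _ (Metric.diam (univ : Set X)).toNNReal
      (fun p => LipschitzWith.of_dist_le_mul fun s t => ?_)
      (fun t => (continuous_apply t).comp hGc)
    rw [(hG p).2.2, mul_comm, Subtype.dist_eq, Real.dist_eq, Real.coe_toNNReal _ Metric.diam_nonneg]
    exact mul_le_mul_of_nonneg_right (Metric.dist_le_diam_of_mem isCompact_univ.isBounded
      (mem_univ _) (mem_univ _)) (abs_nonneg _)
  classical
  refine ⟨⟨fun x y t => if hxy : dist x y ≤ ε then G ⟨(x, y), hxy⟩ (projIcc 0 1 zero_le_one t)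
    else x, ?_, ?_, ?_, ?_⟩⟩
  · intro x y hxy
    simpa [hxy] using (hG ⟨(x, y), hxy⟩).1
  · intro x y hxy
    simpa [hxy] using (hG ⟨(x, y), hxy⟩).2.1
  · intro x y hxy s t hs ht
    simpa [hxy, projIcc_of_mem _ hs, projIcc_of_mem _ ht] using
      (hG ⟨(x, y), hxy⟩).2.2 ⟨s, hs⟩ ⟨t, ht⟩
  · rw [continuousOn_iff_continuous_domRestrict]
    have : Continuous fun p : {p : (X × X) × ℝ | dist p.1.1 p.1.2 ≤ ε} =>
        ((⟨p.1.1, p.2⟩ : {p : X × X // dist p.1 p.2 ≤ ε}), projIcc (0 : ℝ) 1 zero_le_one p.1.2) := by fun_prop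
    convert hGj.comp this using 1
    ext p
    exact dif_pos p.2

namespace SegmentMap

variable {X : Type*} [MetricSpace X] {ε : ℝ} (S : SegmentMap X ε)

theorem continuous_comp {W : Type*} [TopologicalSpace W] {f g : W → X} {h : W → ℝ}
    (hf : Continuous f) (hg : Continuous g) (hh : Continuous h)
    (hfg : ∀ w, dist (f w) (g w) ≤ ε) : Continuous fun w => S.seg (f w) (g w) (h w) :=
  S.continuousOn_seg.comp_continuous (f := fun w => ((f w, g w), h w))
    ((hf.prodMk hg).prodMk hh) hfg

theorem dist_left {x y : X} (h : dist x y ≤ ε) {t : ℝ} (ht : t ∈ Icc (0 : ℝ) 1) :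
    dist x (S.seg x y t) = t * dist x y := by
  have := S.dist_seg h (left_mem_Icc.2 zero_le_one) ht
  rwa [S.seg_zero h, zero_sub, abs_neg, abs_of_nonneg ht.1] at this

theorem dist_right {x y : X} (h : dist x y ≤ ε) {t : ℝ} (ht : t ∈ Icc (0 : ℝ) 1) :
    dist (S.seg x y t) y = (1 - t) * dist x y := by
  have := S.dist_seg h ht (right_mem_Icc.2 zero_le_one)
  rwa [S.seg_one h, abs_sub_comm, abs_of_nonneg (sub_nonneg.2 ht.2)] at this

theorem seg_self (hε : 0 ≤ ε) (x : X) {t : ℝ} (ht : t ∈ Icc (0 : ℝ) 1) : S.seg x x t = x := by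
  have h : dist x x ≤ ε := by simpa
  have := S.dist_left h ht
  rw [dist_self, mul_zero] at this
  exact (dist_eq_zero.1 this).symm

end SegmentMap

/-! ### Periodic geodesics from local constant speed -/

section LocallyScaled

variable {X : Type*} [MetricSpace X]

theorem length_Icc_of_locally {f : ℝ → X} {c δ : ℝ} (hc : 0 ≤ c) (hδ : 0 < δ)
    (h : ∀ s t, s ≤ t → t - s < δ → dist (f s) (f t) = (t - s) * c) {s t : ℝ} (hst : s ≤ t) :
    length f (Icc s t) = ENNReal.ofReal ((t - s) * c) := by
  have base : ∀ s t, s ≤ t → t - s < δ →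
      length f (Icc s t) = ENNReal.ofReal ((t - s) * c) := by
    intro s t hst hd
    refine length_Icc_of_dist_eq (g := fun u => u) monotone_id hc hst fun u hu w hw => ?_
    rcases le_total u w with huw | huw
    · rw [h u w huw (by linarith [hu.1, hw.2]), abs_sub_comm, abs_of_nonneg (sub_nonneg.2 huw)]
    · rw [dist_comm, h w u huw (by linarith [hw.1, hu.2]), abs_of_nonneg (sub_nonneg.2 huw)]
  have ind : ∀ n : ℕ, ∀ t, s ≤ t → t - s ≤ n * (δ / 2) →
      length f (Icc s t) = ENNReal.ofReal ((t - s) * c) := by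
    intro n
    induction n with
    | zero => exact fun t hst ht => base s t hst (by simp at ht; linarith)
    | succ n ih =>
      intro t hst ht
      rcases lt_or_ge (t - s) δ with hd | hd
      · exact base s t hst hd
      push_cast at ht
      have h1 := ih (t - δ / 2) (by linarith) (by linarith)
      have h2 := base (t - δ / 2) t (by linarith) (by linarith)
      have h3 := eVariationOn.Icc_add_Icc f (s := univ) (a := s) (b := t - δ / 2) (c := t)
        (by linarith) (by linarith) (mem_univ _)
      simp only [univ_inter] at h3
      rw [length] at h1 h2 ⊢
      rw [← h3, h1, h2, ← ENNReal.ofReal_add (mul_nonneg (by linarith) hc)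
        (mul_nonneg (by linarith) hc)]
      congr 1
      ring
  obtain ⟨n, hn⟩ := exists_nat_ge ((t - s) / (δ / 2))
  exact ind n t hst ((div_le_iff₀ (by positivity)).1 hn)

theorem exists_isPeriodicGeodesic {f : ℝ → X} (hf : Continuous f) (hp : Function.Periodic f 1)
    {c δ : ℝ} (hc : 0 < c) (hδ : 0 < δ)
    (h : ∀ s t, s ≤ t → t - s < δ → dist (f s) (f t) = (t - s) * c) :
    ∃ γ : C(AddCircle (1 : ℝ), X), IsPeriodicGeodesic γ := by
  obtain ⟨γ, hγ⟩ : ∃ γ : C(AddCircle (1 : ℝ), X), ∀ u : ℝ, γ (u : AddCircle (1 : ℝ)) = f u :=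
    ⟨⟨hp.lift, Continuous.quotient_lift hf _⟩, hp.lift_coe⟩
  refine ⟨γ, ?_, ⟨δ, hδ, ?_⟩, ?_⟩
  · refine ⟨((0 : ℝ) : AddCircle (1 : ℝ)), ((δ / 2 : ℝ) : AddCircle (1 : ℝ)), ?_⟩
    simp only [hγ]
    rw [← dist_pos, h 0 (δ / 2) (by linarith) (by linarith)]
    exact mul_pos (by linarith) hc
  · intro s t hst hd
    simp only [hγ]
    rw [length_Icc_of_locally hc.le hδ h hst, edist_dist, h s t hst hd]
  · intro s t hst
    simp only [hγ]
    rw [length_Icc_of_locally hc.le hδ h hst, length_Icc_of_locally hc.le hδ h zero_le_one,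
      ENNReal.ofReal_mul (sub_nonneg.2 hst)]
    simp

/-- A curve of speed at most `c` on an interval whose endpoints are as far apart as possible has
constant speed. -/
theorem dist_eq_of_dist_endpoints {f : ℝ → X} {c p q : ℝ}
    (h : ∀ s t, p ≤ s → s ≤ t → t ≤ q → dist (f s) (f t) ≤ (t - s) * c)
    (hpq : dist (f p) (f q) = (q - p) * c) {s t : ℝ} (hs : p ≤ s) (hst : s ≤ t) (ht : t ≤ q) :
    dist (f s) (f t) = (t - s) * c := by
  have h1 := h p s le_rfl hs (hst.trans ht)
  have h2 := h s t hs hst ht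
  have h3 := h t q (hs.trans hst) ht le_rfl
  have h4 := dist_triangle4 (f p) (f s) (f t) (f q)
  linarith

end LocallyScaled

/-! ### Closed polygons and their midpoints -/

namespace SegmentMap

variable {X : Type*} [MetricSpace X] {ε : ℝ} (S : SegmentMap X ε) {N : ℕ}

/-- The closed polygon with vertices `v`, as an `N`-periodic curve. -/
noncomputable def polygon (v : ZMod N → X) (u : ℝ) : X :=
  S.seg (v (⌊u⌋ : ℤ)) (v ((⌊u⌋ : ℤ) + 1)) (Int.fract u)

/-- The midpoints of the edges of a closed polygon. -/
noncomputable def midpoints (v : ZMod N → X) (i : ZMod N) : X :=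
  S.seg (v i) (v (i + 1)) (1 / 2)

variable {S} {v : ZMod N → X} (hv : ∀ i, dist (v i) (v (i + 1)) ≤ ε)

include hv

theorem polygon_eq (k : ℤ) {u : ℝ} (h1 : (k : ℝ) ≤ u) (h2 : u ≤ k + 1) :
    S.polygon v u = S.seg (v k) (v (k + 1)) (u - k) := by
  rcases h2.lt_or_eq with h2 | rfl
  · have : ⌊u⌋ = k := Int.floor_eq_iff.2 ⟨h1, h2⟩
    rw [polygon, Int.fract, this]
  · have : ⌊(k : ℝ) + 1⌋ = k + 1 := by simp
    rw [polygon, Int.fract, this]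
    push_cast
    rw [sub_self, S.seg_zero (hv _), add_sub_cancel_left, S.seg_one (hv _)]

/-- The closed range in `polygon_eq` lets a vertex be computed from either adjacent edge. -/
theorem polygon_intCast (k : ℤ) : S.polygon v k = v k := by
  rw [polygon_eq hv k le_rfl (by linarith), sub_self, S.seg_zero (hv _)]

theorem polygon_add_half (k : ℤ) : S.polygon v (k + 1 / 2) = S.midpoints v k := by
  rw [polygon_eq hv k (by linarith) (by linarith), add_sub_cancel_left, midpoints]

theorem dist_polygon (k : ℤ) {s t : ℝ} (hs : (k : ℝ) ≤ s) (hst : s ≤ t) (ht : t ≤ k + 1) :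
    dist (S.polygon v s) (S.polygon v t) = (t - s) * dist (v k) (v (k + 1)) := by
  rw [polygon_eq hv k hs (hst.trans ht), polygon_eq hv k (hs.trans hst) ht,
    S.dist_seg (hv _) ⟨by linarith, by linarith⟩ ⟨by linarith, by linarith⟩, abs_sub_comm,
    abs_of_nonneg (by linarith)]
  ring

theorem dist_polygon_floor_le (u : ℝ) :
    dist (v (⌊u⌋ : ℤ)) (S.polygon v u) ≤ dist (v (⌊u⌋ : ℤ)) (v ((⌊u⌋ : ℤ) + 1)) := by
  rw [polygon, S.dist_left (hv _) ⟨Int.fract_nonneg _, (Int.fract_lt_one _).le⟩]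
  exact mul_le_of_le_one_left dist_nonneg (Int.fract_lt_one _).le

theorem dist_midpoints_le (i : ZMod N) : dist (S.midpoints v i) (S.midpoints v (i + 1)) ≤
    (dist (v i) (v (i + 1)) + dist (v (i + 1)) (v (i + 1 + 1))) / 2 := by
  have h1 := S.dist_right (hv i) (t := 1 / 2) (by constructor <;> norm_num)
  have h2 := S.dist_left (hv (i + 1)) (t := 1 / 2) (by constructor <;> norm_num)
  have h3 := dist_triangle (S.midpoints v i) (v (i + 1)) (S.midpoints v (i + 1))
  simp only [midpoints] at h3 ⊢
  linarith

theorem dist_self_midpoints (i : ZMod N) :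
    dist (v i) (S.midpoints v i) = dist (v i) (v (i + 1)) / 2 := by
  rw [midpoints, S.dist_left (hv i) (by constructor <;> norm_num)]
  ring

/-- Going from midpoint to midpoint through a vertex costs `a / 2 + a / 2`, which `hm` says is the
distance, so the polygon has constant speed across the corner. An interval shorter than `1 / 2` lies
in one edge or between two consecutive midpoints. -/
theorem exists_isPeriodicGeodesic_of_polygon [NeZero N] (hc : Continuous (S.polygon v)) {a : ℝ}
    (ha : 0 < a) (hva : ∀ i, dist (v i) (v (i + 1)) = a)
    (hm : ∀ i, dist (S.midpoints v i) (S.midpoints v (i + 1)) = a) :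
    ∃ γ : C(AddCircle (1 : ℝ), X), IsPeriodicGeodesic γ := by
  have hN : (0 : ℝ) < N := by exact_mod_cast NeZero.pos N
  have key : ∀ s t, s ≤ t → t - s < 1 / 2 →
      dist (S.polygon v s) (S.polygon v t) = (t - s) * a := by
    intro s t hst hd
    have h1 := Int.floor_le s
    have h2 := Int.lt_floor_add_one s
    set k := ⌊s⌋
    rcases le_total t (k + 1) with ht | ht
    · rw [dist_polygon hv k h1 hst ht, hva]
    · refine dist_eq_of_dist_endpoints (p := k + 1 / 2) (q := (k + 1 : ℤ) + 1 / 2) ?_ ?_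
        (by linarith) hst (by push_cast; linarith)
      · intro s t hs hst ht
        push_cast at ht
        rcases le_total t (k + 1) with ht' | ht'
        · rw [dist_polygon hv k (by linarith) hst ht', hva]
        rcases le_total (k + 1 : ℝ) s with hs' | hs'
        · rw [dist_polygon hv (k + 1) (by push_cast; linarith) hst (by push_cast; linarith), hva]
        · have h3 := dist_polygon (S := S) hv k (by linarith) hs' le_rfl
          have h4 := dist_polygon (S := S) hv (k + 1) (s := k + 1) (t := t) (by push_cast; linarith)
            ht' (by push_cast; linarith)
          rw [hva] at h3 h4
          have := dist_triangle (S.polygon v s) (S.polygon v (k + 1)) (S.polygon v t)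
          linarith
      · rw [polygon_add_half hv, polygon_add_half hv]
        push_cast
        rw [hm]
        ring
  refine exists_isPeriodicGeodesic (f := fun u => S.polygon v (N * u)) (c := N * a)
    (δ := 1 / (2 * N)) (by fun_prop) ?_ (by positivity) (by positivity) ?_
  · intro u
    have : (N : ℝ) * (u + 1) = N * u + (N : ℤ) := by push_cast; ring
    simp only [polygon, this, Int.floor_add_intCast, Int.fract_add_intCast]
    simp
  · intro s t hst hd
    rw [key _ _ (by gcongr)]
    · ring
    · rw [lt_div_iff₀ (by positivity)] at hd
      linarith

omit hv

/-- The unit intervals between integers form a locally finite closed cover, and on each the polygon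
is a single segment. -/
theorem continuous_polygon {W : Type*} [TopologicalSpace W] {f : W → ZMod N → X} {h : W → ℝ}
    (hf : Continuous f) (hh : Continuous h) (hfε : ∀ w i, dist (f w i) (f w (i + 1)) ≤ ε) :
    Continuous fun w => S.polygon (f w) (h w) := by
  have hl : LocallyFinite fun k : ℤ => Icc (k : ℝ) (k + 1) := by
    intro u
    refine ⟨Ioo (u - 1) (u + 1), Ioo_mem_nhds (by linarith) (by linarith),
      (finite_Icc (⌊u⌋ - 2) (⌊u⌋ + 2)).subset ?_⟩
    rintro k ⟨y, ⟨h1, h2⟩, h3, h4⟩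
    have h5 := Int.floor_le u
    have h6 := Int.lt_floor_add_one u
    constructor
    · have : ((⌊u⌋ - 2 : ℤ) : ℝ) ≤ k := by push_cast; linarith
      exact_mod_cast this
    · have : (k : ℝ) ≤ ((⌊u⌋ + 2 : ℤ) : ℝ) := by push_cast; linarith
      exact_mod_cast this
  refine (hl.preimage_continuous hh).continuous ?_ (fun k => isClosed_Icc.preimage hh) fun k => ?_
  · exact eq_univ_of_forall fun w =>
      mem_iUnion.2 ⟨⌊h w⌋, Int.floor_le _, (Int.lt_floor_add_one _).le⟩
  · refine (S.continuous_comp (f := fun w => f w k) (g := fun w => f w (k + 1))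
      (h := fun w => h w - k) (by fun_prop) (by fun_prop) (by fun_prop)
      fun w => hfε w _).continuousOn.congr fun w hw => ?_
    exact polygon_eq (hfε w) k hw.1 hw.2

theorem continuous_midpoints {W : Type*} [TopologicalSpace W] {f : W → ZMod N → X}
    (hf : Continuous f) (hfε : ∀ w i, dist (f w i) (f w (i + 1)) ≤ ε) :
    Continuous fun w => S.midpoints (f w) :=
  continuous_pi fun i => S.continuous_comp (by fun_prop) (by fun_prop) continuous_const
    fun w => hfε w i

end SegmentMap

/-- The energy of a closed polygon with vertices `v`. -/
noncomputable def energy {X : Type*} [MetricSpace X] {N : ℕ} [NeZero N] (v : ZMod N → X) : ℝ :=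
  ∑ i, dist (v i) (v (i + 1)) ^ 2

/-! ### Energy under the midpoint map -/

namespace SegmentMap

variable {X : Type*} [MetricSpace X] {ε : ℝ} {S : SegmentMap X ε} {N : ℕ} [NeZero N]
  {v : ZMod N → X} (hv : ∀ i, dist (v i) (v (i + 1)) ≤ ε)

/-- Averaging neighbouring terms allows comparison with the midpoint polygon term by term, hence
also a termwise equality case. -/
theorem energy_eq_sum (v : ZMod N → X) :
    energy v = ∑ i, (dist (v i) (v (i + 1)) ^ 2 + dist (v (i + 1)) (v (i + 1 + 1)) ^ 2) / 2 := by
  have h : ∑ i, dist (v (i + 1)) (v (i + 1 + 1)) ^ 2 = energy v :=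
    Equiv.sum_comp (Equiv.addRight (1 : ZMod N)) fun i => dist (v i) (v (i + 1)) ^ 2
  rw [← Finset.sum_div, Finset.sum_add_distrib, h, ← energy]
  ring

include hv

omit [NeZero N] in
theorem sq_dist_midpoints_le (i : ZMod N) : dist (S.midpoints v i) (S.midpoints v (i + 1)) ^ 2 ≤
    (dist (v i) (v (i + 1)) ^ 2 + dist (v (i + 1)) (v (i + 1 + 1)) ^ 2) / 2 := by
  have h := pow_le_pow_left₀ dist_nonneg (dist_midpoints_le (S := S) hv i) 2
  nlinarith [sq_nonneg (dist (v i) (v (i + 1)) - dist (v (i + 1)) (v (i + 1 + 1)))]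

theorem energy_midpoints_le : energy (S.midpoints v) ≤ energy v := by
  rw [energy_eq_sum v]
  exact Finset.sum_le_sum fun i _ => sq_dist_midpoints_le hv i

theorem energy_eq_zero (h : energy (S.midpoints v) = energy v)
    (hX : ¬ ∃ γ : C(AddCircle (1 : ℝ), X), IsPeriodicGeodesic γ) : energy v = 0 := by
  rw [energy_eq_sum v, energy, Finset.sum_eq_sum_iff_of_le
    fun i _ => sq_dist_midpoints_le hv i] at h
  have h1 : ∀ i, dist (v i) (v (i + 1)) = dist (v (i + 1)) (v (i + 1 + 1)) := by
    intro i
    have h2 := h i (Finset.mem_univ i)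
    have h3 := pow_le_pow_left₀ dist_nonneg (dist_midpoints_le (S := S) hv i) 2
    nlinarith [sq_nonneg (dist (v i) (v (i + 1)) - dist (v (i + 1)) (v (i + 1 + 1)))]
  have h2 : ∀ i, dist (v i) (v (i + 1)) = dist (v 0) (v 1) := by
    have : ∀ n : ℕ, dist (v n) (v (n + 1)) = dist (v 0) (v 1) := by
      intro n
      induction n with
      | zero => simp
      | succ n ih => rw [← ih, h1 n]; simp
    intro i
    simpa using this i.val
  have h3 : ∀ i, dist (S.midpoints v i) (S.midpoints v (i + 1)) = dist (v 0) (v 1) := by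
    intro i
    have := h i (Finset.mem_univ i)
    rw [h2, h2, add_self_div_two] at this
    exact (sq_eq_sq₀ dist_nonneg dist_nonneg).1 this
  have h4 : dist (v 0) (v 1) = 0 := by
    by_contra h0
    exact hX (exists_isPeriodicGeodesic_of_polygon hv
      (continuous_polygon continuous_const continuous_id fun _ => hv)
      (lt_of_le_of_ne dist_nonneg (Ne.symm h0)) h2 h3)
  simp [energy, h2, h4]

end SegmentMap

/-- The closed polygons with edges of length at most `r`. -/
def finePolygons (X : Type*) [MetricSpace X] (N : ℕ) (r : ℝ) : Set (ZMod N → X) :=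
  {v | ∀ i, dist (v i) (v (i + 1)) ≤ r}

/-! ### Uniform energy decrease -/

namespace SegmentMap

variable {X : Type*} [MetricSpace X] {ε : ℝ} {S : SegmentMap X ε} {N : ℕ} {r : ℝ}

theorem midpoints_mem_finePolygons (hr : r ≤ ε) {v : ZMod N → X} (hv : v ∈ finePolygons X N r) :
    S.midpoints v ∈ finePolygons X N r := fun i => by
  have := dist_midpoints_le (S := S) (fun i => (hv i).trans hr) i
  linarith [hv i, hv (i + 1)]

theorem iterate_midpoints_mem_finePolygons (hr : r ≤ ε) {v : ZMod N → X}
    (hv : v ∈ finePolygons X N r) (k : ℕ) : S.midpoints^[k] v ∈ finePolygons X N r := by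
  induction k with
  | zero => exact hv
  | succ k ih =>
    rw [Function.iterate_succ_apply']
    exact midpoints_mem_finePolygons hr ih

theorem isClosed_finePolygons : IsClosed (finePolygons X N r) := by
  simp only [finePolygons, ofPred_forall]
  exact isClosed_iInter fun i => isClosed_le (by fun_prop) continuous_const

variable [NeZero N]

theorem continuous_energy : Continuous (energy : (ZMod N → X) → ℝ) := by
  unfold energy
  fun_prop

theorem dist_le_of_energy_le {v : ZMod N → X} {c : ℝ} (hc : 0 ≤ c) (h : energy v ≤ c ^ 2)
    (i : ZMod N) : dist (v i) (v (i + 1)) ≤ c := by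
  have h1 : dist (v i) (v (i + 1)) ^ 2 ≤ energy v :=
    Finset.single_le_sum (f := fun i => dist (v i) (v (i + 1)) ^ 2)
      (fun i _ => sq_nonneg _) (Finset.mem_univ i)
  exact (sq_le_sq₀ dist_nonneg hc).1 (h1.trans h)

/-- On the compact set of fine polygons of energy at least `c` the energy drop is continuous and
positive, so it has a minimum `δ > 0`. With `M` bounding the energy, `(M - c) / δ` steps suffice. -/
theorem exists_iterate_midpoints_energy_le [CompactSpace X] (hr : r ≤ ε)
    (hX : ¬ ∃ γ : C(AddCircle (1 : ℝ), X), IsPeriodicGeodesic γ) {c : ℝ} (hc : 0 < c) :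
    ∃ k : ℕ, ∀ v ∈ finePolygons X N r, energy (S.midpoints^[k] v) ≤ c := by
  have hD : ContinuousOn S.midpoints (finePolygons X N r) := by
    rw [continuousOn_iff_continuous_domRestrict]
    exact continuous_midpoints continuous_subtype_val fun w i => (w.2 i).trans hr
  set A := finePolygons X N r ∩ {v | c ≤ energy v}
  have hA : IsCompact A :=
    (isClosed_finePolygons.inter (isClosed_le continuous_const continuous_energy)).isCompact
  obtain ⟨M, hM⟩ := (isCompact_univ (X := ZMod N → X)).bddAbove_image
    continuous_energy.continuousOn
  rcases A.eq_empty_or_nonempty with hA0 | hA0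
  · refine ⟨0, fun v hv => ?_⟩
    by_contra h
    exact notMem_empty v (hA0 ▸ ⟨hv, (not_le.1 h).le⟩)
  obtain ⟨w, hw, hmin⟩ := hA.exists_isMinOn hA0
    (f := fun v => energy v - energy (S.midpoints v))
    (continuous_energy.continuousOn.sub
      (continuous_energy.comp_continuousOn (hD.mono inter_subset_left)))
  have hδ : 0 < energy w - energy (S.midpoints w) := by
    have hwε := fun i => (hw.1 i).trans hr
    refine sub_pos.2 (lt_of_le_of_ne (energy_midpoints_le hwε) fun h => ?_)
    have := energy_eq_zero hwε h hX
    have h2 : c ≤ energy w := hw.2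
    linarith
  set δ := energy w - energy (S.midpoints w)
  obtain ⟨k, hk⟩ := exists_nat_ge ((M - c) / δ)
  rw [div_le_iff₀ hδ] at hk
  refine ⟨k, fun v hv => ?_⟩
  have key : ∀ k : ℕ, energy (S.midpoints^[k] v) ≤ c ∨
      energy (S.midpoints^[k] v) ≤ M - k * δ := by
    intro k
    induction k with
    | zero => exact Or.inr (by simpa using hM (mem_image_of_mem energy (mem_univ v)))
    | succ k ih =>
      have hk := iterate_midpoints_mem_finePolygons (S := S) hr hv k
      have hle := energy_midpoints_le (S := S) fun i => (hk i).trans hr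
      rw [Function.iterate_succ_apply']
      by_cases h : energy (S.midpoints^[k] v) ≤ c
      · exact Or.inl (hle.trans h)
      · have h1 : δ ≤ _ := hmin ⟨hk, (not_le.1 h).le⟩
        have h2 := ih.resolve_left h
        push_cast
        exact Or.inr (by linarith)
  rcases key k with h | h
  · exact h
  · linarith

end SegmentMap

/-- A family of closed curves parametrized by `Z` that are constantly `x` over `B`. -/
def IsLoopFamily {Z X : Type*} [TopologicalSpace Z] [TopologicalSpace X] (B : Set Z) (x : X)
    (f : C(Z × I, X)) : Prop :=
  (∀ z, f (z, 0) = f (z, 1)) ∧ ∀ z ∈ B, ∀ t, f (z, t) = x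

/-! ### Homotopies of loop families -/

namespace SegmentMap

variable {X Z : Type*} [MetricSpace X] {ε : ℝ} {S : SegmentMap X ε} {N : ℕ} [TopologicalSpace Z]
  {B : Set Z} {x : X}

/-- Slide each point along the segment from `f w` to `g w`. Over `B` the segments are constant. -/
theorem homotopicWith_of_dist_le (S : SegmentMap X ε) (hε : 0 ≤ ε) {f g : C(Z × I, X)}
    (hf : IsLoopFamily B x f) (hg : IsLoopFamily B x g) (h : ∀ w, dist (f w) (g w) ≤ ε) :
    f.HomotopicWith g (IsLoopFamily B x) := by
  refine ⟨⟨⟨⟨fun p => S.seg (f p.2) (g p.2) p.1, S.continuous_comp (by fun_prop) (by fun_prop)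
    (by fun_prop) fun p => h p.2⟩, fun w => ?_, fun w => ?_⟩, fun s => ⟨fun z => ?_,
    fun z hz t => ?_⟩⟩⟩
  · simp [S.seg_zero (h w)]
  · simp [S.seg_one (h w)]
  · simp [hf.1, hg.1]
  · simp [hf.2 z hz, hg.2 z hz, S.seg_self hε x s.2]

/-- The family of polygons with a given family of vertices. -/
noncomputable def polygonFamily (S : SegmentMap X ε) (w : C(Z, ZMod N → X))
    (hw : ∀ z i, dist (w z i) (w z (i + 1)) ≤ ε) : C(Z × I, X) :=
  ⟨fun p => S.polygon (w p.1) (N * p.2),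
    continuous_polygon (by fun_prop) (by fun_prop) fun p => hw p.1⟩

theorem isLoopFamily_polygonFamily (hε : 0 ≤ ε) {w : C(Z, ZMod N → X)}
    (hw : ∀ z i, dist (w z i) (w z (i + 1)) ≤ ε) (hB : ∀ z ∈ B, ∀ i, w z i = x) :
    IsLoopFamily B x (S.polygonFamily w hw) := by
  constructor
  · intro z
    have h0 := polygon_intCast (S := S) (hw z) 0
    have h1 := polygon_intCast (S := S) (hw z) N
    push_cast at h0 h1
    simp [polygonFamily, h0, h1]
  · intro z hz t
    simp only [polygonFamily, ContinuousMap.coe_mk, polygon, hB z hz]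
    exact S.seg_self hε x ⟨Int.fract_nonneg _, (Int.fract_lt_one _).le⟩

/-- Every family of fine polygons is homotopic to its iterated midpoint family. -/
theorem homotopicWith_iterate_midpoints {r : ℝ} (hr0 : 0 ≤ r) (hr : 5 / 2 * r ≤ ε)
    (w : C(Z, ZMod N → X)) (hw : ∀ z, w z ∈ finePolygons X N r) (hB : ∀ z ∈ B, ∀ i, w z i = x)
    (k : ℕ) : ∃ (w' : C(Z, ZMod N → X)) (hw' : ∀ z i, dist (w' z i) (w' z (i + 1)) ≤ ε),
      (∀ z, w' z = S.midpoints^[k] (w z)) ∧ (∀ z ∈ B, ∀ i, w' z i = x) ∧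
      (S.polygonFamily w fun z i => (hw z i).trans (by linarith)).HomotopicWith
        (S.polygonFamily w' hw') (IsLoopFamily B x) := by
  have hrε : r ≤ ε := by linarith
  have hε : 0 ≤ ε := by linarith
  induction k with
  | zero => exact ⟨w, fun z i => (hw z i).trans hrε, fun z => rfl, hB,
      .refl _ (isLoopFamily_polygonFamily hε _ hB)⟩
  | succ k ih =>
    obtain ⟨w', hw', h1, h2, h3⟩ := ih
    have hfine : ∀ z, w' z ∈ finePolygons X N r := fun z => by
      rw [h1]
      exact iterate_midpoints_mem_finePolygons hrε (hw z) k
    have hfine' := fun z => midpoints_mem_finePolygons (S := S) hrε (hfine z)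
    have hB' : ∀ z ∈ B, ∀ i, S.midpoints (w' z) i = x := fun z hz i => by
      simp only [midpoints, h2 z hz]
      exact S.seg_self hε x (by constructor <;> norm_num)
    have hw'' := fun z i => (hfine' z i).trans hrε
    refine ⟨⟨fun z => S.midpoints (w' z), continuous_midpoints w'.continuous hw'⟩, hw'',
      fun z => ?_, hB', h3.trans ?_⟩
    · rw [Function.iterate_succ_apply', ← h1]
      rfl
    · refine S.homotopicWith_of_dist_le hε (isLoopFamily_polygonFamily hε _ h2)
        (isLoopFamily_polygonFamily hε _ hB') fun p => ?_
      -- Travel back to the vertex, on to its midpoint, then along the new edge: at most `r + r / 2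
      -- + r`, whence the `5 / 2`.
      set u := (N : ℝ) * p.2
      have e1 := (dist_polygon_floor_le (S := S) (hw' p.1) u).trans (hfine p.1 _)
      have e2 := dist_self_midpoints (S := S) (hw' p.1) (⌊u⌋ : ℤ)
      have e3 := (dist_polygon_floor_le (S := S) (hw'' p.1) u).trans (hfine' p.1 _)
      have e4 := dist_triangle4 (S.polygon (w' p.1) u) (w' p.1 (⌊u⌋ : ℤ))
        (S.midpoints (w' p.1) (⌊u⌋ : ℤ)) (S.polygon (S.midpoints (w' p.1)) u)
      rw [dist_comm] at e1
      have e5 := hfine p.1 (⌊u⌋ : ℤ)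
      have e6 : dist (S.polygon (w' p.1) u) (S.polygon (S.midpoints (w' p.1)) u) ≤ ε := by
        linarith
      exact e6

/-- Every family of closed curves is homotopic to a family of fine polygons. -/
theorem exists_homotopicWith_polygonFamily {Z : Type*} [MetricSpace Z] [CompactSpace Z]
    {B : Set Z} (S : SegmentMap X ε) {r : ℝ} (hr : 0 < r)
    (hrε : 2 * r ≤ ε) {f : C(Z × I, X)} (hf : IsLoopFamily B x f) :
    ∃ (N : ℕ) (_ : NeZero N) (w : C(Z, ZMod N → X)) (hw : ∀ z, w z ∈ finePolygons X N r),
      (∀ z ∈ B, ∀ i, w z i = x) ∧ f.HomotopicWith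
        (S.polygonFamily w fun z i => (hw z i).trans (by linarith)) (IsLoopFamily B x) := by
  obtain ⟨δ, hδ, hfδ⟩ := Metric.uniformContinuous_iff.1
    (CompactSpace.uniformContinuous_of_continuous f.continuous) r hr
  obtain ⟨n, hn⟩ := exists_nat_one_div_lt hδ
  have hε : 0 ≤ ε := by linarith
  set N := n + 1 with hN
  have hNpos : (0 : ℝ) < N := by positivity
  have hn' : 1 / (N : ℝ) < δ := by rw [hN]; exact_mod_cast hn
  let q : ℕ → I := fun k => projIcc 0 1 zero_le_one ((k : ℝ) / N)
  have hq : ∀ k, k ≤ N → (q k : ℝ) = (k : ℝ) / N := fun k hk => by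
    have : (k : ℝ) / N ∈ Icc (0 : ℝ) 1 :=
      ⟨by positivity, (div_le_one hNpos).2 (by exact_mod_cast hk)⟩
    simp only [q, projIcc_of_mem _ this]
  let w : C(Z, ZMod N → X) := ⟨fun z i => f (z, q i.val), by fun_prop⟩
  -- The case `k = N` wraps round to vertex `0` and uses that the curves are closed.
  have hwk : ∀ z, ∀ k : ℕ, k ≤ N → w z k = f (z, q k) := by
    intro z k hk
    rcases hk.lt_or_eq with hk | rfl
    · simp only [w, ContinuousMap.coe_mk, ZMod.val_natCast_of_lt hk]
    · have h0 : q 0 = 0 := Subtype.ext (by rw [hq 0 (by omega)]; simp)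
      have h1 : q N = 1 := Subtype.ext (by rw [hq N le_rfl]; simp [hNpos.ne'])
      simp only [w, ContinuousMap.coe_mk, CharP.cast_eq_zero, ZMod.val_zero, h0, h1, hf.1]
  have hclose : ∀ z, ∀ k : ℕ, k ≤ N → ∀ t : I, |(k : ℝ) / N - t| ≤ 1 / N →
      dist (w z k) (f (z, t)) ≤ r := by
    intro z k hk t ht
    rw [hwk z k hk]
    refine (hfδ ?_).le
    rw [Prod.dist_eq, dist_self, Subtype.dist_eq, Real.dist_eq, hq k hk]
    exact max_lt hδ (ht.trans_lt hn')
  have hw : ∀ z, w z ∈ finePolygons X N r := by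
    intro z i
    have hi : i.val + 1 ≤ N := ZMod.val_lt i
    have h := hclose z i.val (by omega) (q (i.val + 1)) (by
      rw [hq _ hi]
      push_cast
      rw [div_sub_div_same, sub_add_cancel_left, abs_div, abs_neg, abs_one, abs_of_pos hNpos])
    rw [← hwk z _ hi] at h
    simpa using h
  have hB : ∀ z ∈ B, ∀ i, w z i = x := fun z hz i => hf.2 z hz _
  refine ⟨N, inferInstance, w, hw, hB, S.homotopicWith_of_dist_le hε hf
    (isLoopFamily_polygonFamily hε _ hB) ?_⟩
  rintro ⟨z, t⟩
  set u := (N : ℝ) * t with hu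
  have h1 := (dist_polygon_floor_le (S := S) (fun i => (hw z i).trans (by linarith)) u).trans
    (hw z _)
  have hu0 : 0 ≤ u := mul_nonneg hNpos.le t.2.1
  have hk : ⌊u⌋₊ ≤ N := by
    have : u ≤ N := mul_le_of_le_one_right hNpos.le t.2.2
    exact_mod_cast (Nat.floor_le hu0).trans this
  have h2 := hclose z ⌊u⌋₊ hk t (by
    have ht : (t : ℝ) = u / N := by rw [hu]; field_simp
    rw [ht, div_sub_div_same, abs_div, abs_of_pos hNpos]
    gcongr
    rw [abs_le]
    constructor <;> linarith [Nat.floor_le hu0, Nat.lt_floor_add_one u])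
  have h3 : ((⌊u⌋ : ℤ) : ZMod N) = (⌊u⌋₊ : ℕ) := by
    rw [← Int.natCast_floor_eq_floor hu0]
    simp
  rw [h3] at h1
  have h4 := dist_triangle (f (z, t)) (w z (⌊u⌋₊ : ℕ)) (S.polygon (w z) u)
  rw [dist_comm] at h2
  have h5 : dist (f (z, t)) (S.polygon (w z) u) ≤ ε := by linarith
  exact h5

theorem dist_zero_le [NeZero N] {r : ℝ} (hr : 0 ≤ r) {v : ZMod N → X}
    (hv : v ∈ finePolygons X N r) (i : ZMod N) : dist (v 0) (v i) ≤ N * r := by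
  have h : ∀ n : ℕ, dist (v 0) (v n) ≤ n * r := by
    intro n
    induction n with
    | zero => simp
    | succ n ih =>
      have h1 := dist_triangle (v 0) (v n) (v (n + 1))
      have h2 := hv n
      push_cast
      linarith
  have h1 := h i.val
  rw [ZMod.natCast_zmod_val] at h1
  refine h1.trans ?_
  gcongr
  exact (ZMod.val_lt i).le

/-- If there is no periodic geodesic then every family of closed curves is homotopic to a family
of constant curves. -/
theorem exists_homotopicWith_const [CompactSpace X] {Z : Type*} [MetricSpace Z] [CompactSpace Z]
    {B : Set Z} (S : SegmentMap X ε) (hε : 0 < ε)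
    (hX : ¬ ∃ γ : C(AddCircle (1 : ℝ), X), IsPeriodicGeodesic γ)
    {f : C(Z × I, X)} (hf : IsLoopFamily B x f) :
    ∃ p : C(Z, X), f.HomotopicWith (p.comp ContinuousMap.fst) (IsLoopFamily B x) := by
  have hr : 0 < ε / 4 := by positivity
  obtain ⟨N, hN, w, hw, hB, h⟩ := S.exists_homotopicWith_polygonFamily hr (by linarith) hf
  have hN' : (0 : ℝ) < N := by exact_mod_cast NeZero.pos N
  -- Vertices are within `N * c` of vertex `0` and other points within `c` more, so `(N + 1) * c =
  -- ε` permits the final contraction.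
  set c := ε / (N + 1) with hc
  have hc0 : 0 < c := by positivity
  obtain ⟨k, hk⟩ := S.exists_iterate_midpoints_energy_le (N := N) (r := ε / 4) (by linarith) hX
    (pow_pos hc0 2)
  obtain ⟨w', hw', h1, h2, h3⟩ := homotopicWith_iterate_midpoints (S := S) hr.le (by linarith)
    w hw hB k
  have hfine : ∀ z, w' z ∈ finePolygons X N c := fun z i => by
    rw [h1]
    exact dist_le_of_energy_le hc0.le (hk _ (hw z)) i
  refine ⟨⟨fun z => w' z 0, by fun_prop⟩, h.trans (h3.trans (S.homotopicWith_of_dist_le hε.le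
    (isLoopFamily_polygonFamily hε.le _ h2) ⟨fun z => rfl, fun z hz t => h2 z hz 0⟩ ?_))⟩
  rintro ⟨z, t⟩
  have e1 := (dist_polygon_floor_le (S := S) (hw' z) (N * t)).trans (hfine z _)
  have e2 := dist_zero_le hc0.le (hfine z) (⌊(N : ℝ) * t⌋ : ℤ)
  have e3 := dist_triangle (w' z 0) (w' z (⌊(N : ℝ) * t⌋ : ℤ)) (S.polygon (w' z) (N * t))
  have e4 : (N + 1) * c = ε := by rw [hc]; field_simp
  have e5 : dist (S.polygon (w' z) (N * t)) (w' z 0) ≤ ε := by rw [dist_comm]; linarith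
  exact e5

end SegmentMap

/-- A family of based loops that is freely homotopic to a family of constant loops is
null-homotopic relative to the boundary. -/
theorem homotopicWith_const_of_isLoopFamily {Z X : Type*} [TopologicalSpace Z]
    [TopologicalSpace X] {B : Set Z} {x : X} {f : C(Z × I, X)} (h0 : ∀ z, f (z, 0) = x)
    {p : C(Z, X)} (h : f.HomotopicWith (p.comp ContinuousMap.fst) (IsLoopFamily B x)) :
    f.HomotopicWith (ContinuousMap.const _ x)
      fun g => ∀ z t, t = 0 ∨ t = 1 ∨ z ∈ B → g (z, t) = x := by
  obtain ⟨H⟩ := h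
  have hH1 : ∀ s z, H (s, (z, 0)) = H (s, (z, 1)) := fun s z => (H.prop s).1 z
  have hHB : ∀ s, ∀ z ∈ B, ∀ t, H (s, (z, t)) = x := fun s z hz t => (H.prop s).2 z hz t
  let P : ℝ → I := projIcc 0 1 zero_le_one
  have hP : Continuous P := continuous_projIcc
  have hP0 : ∀ {a : ℝ}, a ≤ 0 → P a = 0 := fun h => projIcc_of_le_left _ h
  have hP1 : ∀ {a : ℝ}, 1 ≤ a → P a = 1 := fun h => projIcc_of_right_le _ h
  have hPI : ∀ t : I, P t = t := fun t => projIcc_val _ t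
  -- After clamping by `P`, this runs from `0` to `1` on the first third, stays at `1`, and returns
  -- on the last third.
  let m : I → ℝ := fun t => min (3 * t) (3 - 3 * t)
  have hm : Continuous m := by fun_prop
  have hm0 : m 0 = 0 := by simp [m]
  have hm1 : m 1 = 0 := by simp [m]
  have hmn : ∀ t : I, 0 ≤ m t := fun t => le_min (by linarith [t.2.1]) (by linarith [t.2.2])
  let g : C(Z × I, X) := ⟨fun q => H (P (m q.2), (q.1, 0)), by fun_prop⟩
  -- On the middle third the loop at time `1` is traversed. It is constant, so only the base point's
  -- track, out and back, remains.
  have hHg : ∀ z t, H (P (min 1 (m t)), (z, P (3 * t - 1))) = g (z, t) := by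
    intro z t
    have hPm : P (min 1 (m t)) = P (m t) := by
      rcases le_total 1 (m t) with h | h
      · rw [min_eq_left h, hP1 le_rfl, hP1 h]
      · rw [min_eq_right h]
    rw [hPm]
    change _ = H (P (m t), (z, 0))
    rcases le_total (3 * (t : ℝ) - 1) 0 with h | h
    · rw [hP0 h]
    rcases le_total 1 (3 * (t : ℝ) - 1) with h' | h'
    · rw [hP1 h', hH1]
    · rw [hP1 (le_min (by linarith) (by linarith)), H.apply_one, H.apply_one]
      rfl
  have e1 : f.HomotopicWith g fun g => ∀ z t, t = 0 ∨ t = 1 ∨ z ∈ B → g (z, t) = x := by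
    -- At time `s`: follow the base point's track up to time `s`, run the loop at time `s`, and
    -- return. The track reaches `s` at `t = s / 3`, no later than the loop's start at `t = s / (1 +
    -- 2 * s)`.
    refine ⟨⟨⟨⟨fun q => H (P (min q.1 (m q.2.2)), (q.2.1, P ((1 + 2 * q.1) * q.2.2 - q.1))),
      by fun_prop⟩, ?_, ?_⟩, ?_⟩⟩
    · rintro ⟨z, t⟩
      simp [hmn, hP0, hPI]
    · rintro ⟨z, t⟩
      have := hHg z t
      norm_num [← this]
    · rintro s z t (rfl | rfl | hz)
      · simp [hm0, hP0, s.2.1, h0]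
      · have h1 : P (1 + 2 * s - s) = 1 := hP1 (by linarith [s.2.1])
        have h2 : f (z, 1) = x := by rw [← H.apply_zero, ← hH1, H.apply_zero, h0]
        simp [hm1, hP0, s.2.1, h1, h2]
      · exact hHB _ z hz _
  have e2 : g.HomotopicWith (ContinuousMap.const _ x)
      fun g => ∀ z t, t = 0 ∨ t = 1 ∨ z ∈ B → g (z, t) = x := by
    -- Going less and less far along the track before turning back contracts it to `x`.
    refine ⟨⟨⟨⟨fun q => H (P ((1 - q.1) * m q.2.2), (q.2.1, 0)), by fun_prop⟩, ?_, ?_⟩, ?_⟩⟩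
    · rintro ⟨z, t⟩
      simp [g]
    · rintro ⟨z, t⟩
      simp [hP0, h0]
    · rintro s z t (rfl | rfl | hz)
      · simp [hm0, hP0, h0]
      · simp [hm1, hP0, h0]
      · exact hHB _ z hz _
  exact e1.trans e2

/-- Coordinate `0` serves as loop parameter and the remaining cube as parameter space, its boundary
playing the role of `B`. -/
theorem genLoop_homotopic_const {X : Type*} [MetricSpace X] [CompactSpace X]
    (hX : IsLocallyUniquelyGeodesic X)
    (hγ : ¬ ∃ γ : C(AddCircle (1 : ℝ), X), IsPeriodicGeodesic γ)
    {n : ℕ} {x : X} (f : GenLoop (Fin (n + 1)) X x) : GenLoop.Homotopic f GenLoop.const := by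
  obtain ⟨ε, hε, ⟨S⟩⟩ := exists_segmentMap hX
  let F : C(({ j : Fin (n + 1) // j ≠ 0 } → I) × I, X) :=
    ⟨fun p => f (Cube.insertAt 0 (p.2, p.1)), by fun_prop⟩
  have hb : ∀ z t, t = 0 ∨ t = 1 ∨ z ∈ Cube.boundary { j : Fin (n + 1) // j ≠ 0 } →
      F (z, t) = x := fun z t h =>
    f.2 _ (Cube.insertAt_boundary 0 (by tauto))
  have hF : IsLoopFamily (Cube.boundary _) x F :=
    ⟨fun z => by rw [hb z 0 (by tauto), hb z 1 (by tauto)], fun z hz t => hb z t (by tauto)⟩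
  obtain ⟨p, hp⟩ := S.exists_homotopicWith_const hε hγ hF
  obtain ⟨H⟩ := homotopicWith_const_of_isLoopFamily (fun z => hb z 0 (by tauto)) hp
  refine ⟨⟨⟨⟨fun q => H (q.1, ((Cube.splitAt 0 q.2).2, (Cube.splitAt 0 q.2).1)), by fun_prop⟩,
    fun y => ?_, fun y => ?_⟩, fun s y hy => ?_⟩⟩
  · change H (0, _) = _
    rw [H.apply_zero]
    exact congrArg f ((Cube.splitAt 0).symm_apply_apply y)
  · change H (1, _) = _
    rw [H.apply_one]
    rfl
  · have h1 : f.1 y = x := f.2 y hy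
    refine Eq.trans (H.prop s _ _ ?_) h1.symm
    obtain ⟨j, hj⟩ := hy
    by_cases hj0 : j = 0
    · subst hj0
      exact hj.elim Or.inl fun h => Or.inr (Or.inl h)
    · exact Or.inr (Or.inr ⟨⟨j, hj0⟩, hj⟩)

end LocUniqGeod

theorem mainTheorem1 (X : Type*) [MetricSpace X] [CompactSpace X]
    (hX : LocUniqGeod.IsLocallyUniquelyGeodesic X)
    (n : ℕ) (hn : 1 ≤ n) (x : X) (hπ : Nontrivial (HomotopyGroup.Pi n X x)) :
    ∃ γ : C(AddCircle (1 : ℝ), X), LocUniqGeod.IsPeriodicGeodesic γ := by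
  by_contra hγ
  obtain ⟨n, rfl⟩ := Nat.exists_eq_add_of_le' hn
  refine not_subsingleton (HomotopyGroup.Pi (n + 1) X x) ⟨fun a b => ?_⟩
  induction a using Quotient.inductionOn with | _ f
  induction b using Quotient.inductionOn with | _ g
  exact Quotient.sound ((LocUniqGeod.genLoop_homotopic_const hX hγ f).trans
    (LocUniqGeod.genLoop_homotopic_const hX hγ g).symm)
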